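/- For a group $G$ with a finite generating set $S$, let $l_S(g)$ be the length of a shortest word in the letters $S\cup S^{-1}$ representing $g\in G$, let $a_n$ be the number of $g\in G$ with $l_S(g)=n$, and call $\sum_{n\ge 0}a_nt^n$ the growth series of $G$ with respect to $S$. For $n\ge 1$ let $$C_n(t)=\begin{cases}1+2t+\dots+2t^{(n-1)/2} & n \text{ odd},\\ 1+2t+\dots+2t^{n/2-1}+t^{n/2} & n\text{ even},\end{cases}\qquad C_\infty(t)=\frac{1+t}{1-t},$$ and let $m_r(t)=t^{r/2}$ if $r$ is even and $m_r(t)=0$ if $r$ is odd. Then $C_n$ and $C_\infty$ are the growth series of the cyclic group of order $n$ and of the infinite cyclic group, each with respect to a single generator; and for all integers $p,q>1$ the growth series of the group $$T'_{p,q}=\langle x,y,z\mid x^p=y^q=z\rangle$$ with respect to the generating set $\{x,y,z\}$ is the rational function $$A(t)=\frac{C_\infty(t)C_p(t)C_q(t)}{C_p(t)+C_q(t)-C_p(t)C_q(t)}+\frac{m_q(t)C_p(t)^2+m_p(t)C_q(t)^2}{\bigl(C_p(t)+C_q(t)-C_p(t)C_q(t)\bigr)^2}.$$ -/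

import Mathlib

open scoped Polynomial PowerSeries LaurentSeries

noncomputable section

/-- `IsWordFor S w g`: `w` is a word in the letters `S ∪ S⁻¹` that represents `g`. -/
def IsWordFor {G : Type*} [Group G] (S : Set G) (w : List G) (g : G) : Prop :=
  (∀ a ∈ w, a ∈ S ∨ a⁻¹ ∈ S) ∧ w.prod = g

/-- The word length `l_S(g)`: the length of a shortest word over `S` (letters from `S` and their
inverses) that represents `g`; it is `⊤` if there is no such word. -/
def wordLength {G : Type*} [Group G] (S : Set G) (g : G) : ℕ∞ :=
  ⨅ (w : List G) (_ : IsWordFor S w g), (w.length : ℕ∞)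

/-- The growth series `∑ aₙ tⁿ` of `G` with respect to `S`, where `aₙ` is the number of elements
of word length `n` (the spheres are finite as soon as `S` is finite). -/
def growthSeries {G : Type*} [Group G] (S : Set G) : ℚ⟦X⟧ :=
  PowerSeries.mk fun n => (Set.ncard {g : G | wordLength S g = (n : ℕ∞)} : ℚ)

/-- The three generator symbols. -/
inductive TorusGen : Type
  | x
  | y
  | z

/-- The relators of `⟨x, y, z | x ^ p = y ^ q = z⟩`. -/
def torusRelators (p q : ℕ) : Set (FreeGroup TorusGen) :=
  {FreeGroup.of TorusGen.x ^ p * (FreeGroup.of TorusGen.y ^ q)⁻¹,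
    FreeGroup.of TorusGen.y ^ q * (FreeGroup.of TorusGen.z)⁻¹}

/-- The torus link group, presented as `⟨x, y, z | x ^ p = y ^ q = z⟩`. -/
abbrev TorusLinkGroup (p q : ℕ) : Type :=
  PresentedGroup (torusRelators p q)

/-- The generating set `{x, y, z}` of the torus link group. -/
def torusGenerators (p q : ℕ) : Set (TorusLinkGroup p q) :=
  {PresentedGroup.of TorusGen.x, PresentedGroup.of TorusGen.y, PresentedGroup.of TorusGen.z}

/-- The polynomial `C_n(t)` for `n ≥ 1`: it is `1 + 2t + ⋯ + 2t^((n-1)/2)` if `n` is odd, and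
`1 + 2t + ⋯ + 2t^(n/2-1) + t^(n/2)` if `n` is even. -/
def cyclicPoly (n : ℕ) : ℚ[X] :=
  if Even n then
    1 + ∑ k ∈ Finset.Icc 1 (n / 2 - 1), 2 * Polynomial.X ^ k + Polynomial.X ^ (n / 2)
  else
    1 + ∑ k ∈ Finset.Icc 1 ((n - 1) / 2), 2 * Polynomial.X ^ k

/-- `m_r(t) = t^(r/2)` if `r` is even, and `0` if `r` is odd. -/
def middlePoly (r : ℕ) : ℚ[X] :=
  if Even r then Polynomial.X ^ (r / 2) else 0

/-- `C_n(t)` as a rational function. -/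
def cyclicRat (n : ℕ) : RatFunc ℚ := algebraMap ℚ[X] (RatFunc ℚ) (cyclicPoly n)

/-- `m_r(t)` as a rational function. -/
def middleRat (r : ℕ) : RatFunc ℚ := algebraMap ℚ[X] (RatFunc ℚ) (middlePoly r)

/-- `C_∞(t) = (1 + t) / (1 - t)`. -/
def infiniteCyclicRat : RatFunc ℚ := (1 + RatFunc.X) / (1 - RatFunc.X)

/-- For `p, q ≥ 1` the polynomial `C_p + C_q - C_p C_q` has constant term `1`, so that it may be
used as a denominator. -/
theorem cyclicRat_denominator_ne_zero {p q : ℕ} (hp : 0 < p) (hq : 0 < q) :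
    cyclicRat p + cyclicRat q - cyclicRat p * cyclicRat q ≠ 0 := by
  have key : ∀ n : ℕ, 0 < n → (cyclicPoly n).eval 0 = 1 := by
    intro n hn
    have hsum : ∀ N : ℕ,
        ∑ k ∈ Finset.Icc 1 N, (2 * (Polynomial.X : ℚ[X]) ^ k).eval 0 = 0 := by
      intro N
      refine Finset.sum_eq_zero fun k hk => ?_
      have : k ≠ 0 := by have := (Finset.mem_Icc.mp hk).1; omega
      simp [this]
    unfold cyclicPoly
    split_ifs with h
    · have : n / 2 ≠ 0 := by obtain ⟨r, hr⟩ := h; omega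
      rw [Polynomial.eval_add, Polynomial.eval_add, Polynomial.eval_finsetSum, hsum]
      simp [this]
    · rw [Polynomial.eval_add, Polynomial.eval_finsetSum, hsum]
      simp
  unfold cyclicRat
  rw [← map_add, ← map_mul, ← map_sub]
  intro h
  have h0 := (map_eq_zero_iff _ (RatFunc.algebraMap_injective ℚ)).mp h
  have h1 := congrArg (Polynomial.eval 0) h0
  simp [key p hp, key q hq] at h1

end

/-!
The relations make `z` central, and the quotient by `⟨z⟩` is the free product `ℤ/p * ℤ/q`. Writing
each syllable of a reduced word with the exponent of least absolute value, every element of the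
group becomes uniquely `z ^ c * w`, with `c` an integer and `w` a reduced word of the free product
(`normalForm`). Uniqueness holds because the free product recovers `w`, and the homomorphism
to `ℤ` with `x ↦ q`, `y ↦ p`, `z ↦ p * q` then recovers `c` (`normalForm_injective`).

The length of `z ^ c * w` is the sum of the absolute values of the exponents of `w` plus the
distance from `0` to `{c, …, c + m}`, where `m` is the number of middle syllables of `w`, those with
exponent `n / 2` in a factor of even order `n`: since `g ^ (n / 2) = z * g ^ (-(n / 2))`, each of
them can give a factor `z` away for free (`hasWordOfLength_normalForm`). No word is shorter, since
multiplication by a letter changes this quantity by at most one (`normalForm_step`).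

For a fixed `w`, summing over `c` gives `C_∞(t) + m`. So the growth series is `C_∞ * W + M`, where
`W` counts reduced words and `M` counts reduced words with weight `m`
(`weightSeries_normalFormLength`). Splitting off a possibly trivial first syllable in a given factor,
and noting that every nonempty word starts in exactly one factor, yields linear equations that
determine `W` and `M` (`mul_wordSeries_one`, `sq_mul_wordSeries_middleWeight`).
-/

/-! ### Word length from a normal form -/

theorem IsWordFor.mul {G : Type*} [Group G] {S : Set G} {v w : List G} {g h : G}
    (hv : IsWordFor S v g) (hw : IsWordFor S w h) : IsWordFor S (v ++ w) (g * h) := by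
  refine ⟨fun a ha => ?_, by rw [List.prod_append, hv.2, hw.2]⟩
  rcases List.mem_append.1 ha with ha | ha
  exacts [hv.1 a ha, hw.1 a ha]

/-- `g` is represented by some word over `S` of length at most `k`. -/
def HasWordOfLength {G : Type*} [Group G] (S : Set G) (g : G) (k : ℕ) : Prop :=
  ∃ w, IsWordFor S w g ∧ w.length ≤ k

namespace HasWordOfLength

variable {G : Type*} [Group G] {S : Set G}

theorem one : HasWordOfLength S 1 0 := ⟨[], ⟨by simp, rfl⟩, le_rfl⟩

theorem mul {g h : G} {k l : ℕ} (hg : HasWordOfLength S g k) (hh : HasWordOfLength S h l) :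
    HasWordOfLength S (g * h) (k + l) := by
  obtain ⟨v, hv, hvk⟩ := hg
  obtain ⟨w, hw, hwl⟩ := hh
  exact ⟨v ++ w, hv.mul hw, by rw [List.length_append]; omega⟩

theorem zpow {s : G} (hs : s ∈ S) (a : ℤ) : HasWordOfLength S (s ^ a) a.natAbs := by
  have key : ∀ t : G, (t ∈ S ∨ t⁻¹ ∈ S) → ∀ k : ℕ, HasWordOfLength S (t ^ k) k := fun t ht k =>
    ⟨List.replicate k t, ⟨fun b hb => by rwa [List.eq_of_mem_replicate hb], by simp⟩, by simp⟩
  obtain ha | ha := Int.natAbs_eq a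
  · have h := key s (Or.inl hs) a.natAbs
    rwa [← zpow_natCast, ← ha] at h
  · have h := key s⁻¹ (Or.inr (by simpa using hs)) a.natAbs
    rwa [inv_pow, ← zpow_natCast, ← zpow_neg, ← ha] at h

end HasWordOfLength

/-- A function on a set of normal forms that vanishes at `1` and grows by at most one under
left multiplication by a letter bounds the length of every word from below. -/
theorem exists_normalForm_of_word {G N : Type*} [Group G] {S : Set G} {E : N → G} {ℓ : N → ℕ}
    {e : N} (he : E e = 1) (hℓ : ℓ e = 0)
    (step : ∀ a, (a ∈ S ∨ a⁻¹ ∈ S) → ∀ n, ∃ n', E n' = a * E n ∧ ℓ n' ≤ ℓ n + 1)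
    (w : List G) (hw : ∀ a ∈ w, a ∈ S ∨ a⁻¹ ∈ S) : ∃ n, E n = w.prod ∧ ℓ n ≤ w.length := by
  induction w with
  | nil => exact ⟨e, by simpa using he, hℓ.le⟩
  | cons a w ih =>
    obtain ⟨n, hn, hle⟩ := ih fun b hb => hw b (List.mem_cons_of_mem _ hb)
    obtain ⟨n', hn', hle'⟩ := step a (hw a List.mem_cons_self) n
    exact ⟨n', by rw [hn', hn, List.prod_cons], by rw [List.length_cons]; omega⟩

theorem wordLength_normalForm {G N : Type*} [Group G] {S : Set G} {E : N → G} {ℓ : N → ℕ}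
    {e : N} (he : E e = 1) (hℓ : ℓ e = 0) (hE : Function.Injective E)
    (step : ∀ a, (a ∈ S ∨ a⁻¹ ∈ S) → ∀ n, ∃ n', E n' = a * E n ∧ ℓ n' ≤ ℓ n + 1)
    (upper : ∀ n, HasWordOfLength S (E n) (ℓ n)) (n : N) : wordLength S (E n) = ℓ n := by
  apply le_antisymm
  · obtain ⟨w, hw, hle⟩ := upper n
    exact (iInf₂_le w hw).trans (by exact_mod_cast hle)
  · refine le_iInf₂ fun w hw => ?_
    obtain ⟨n', hn', hle⟩ := exists_normalForm_of_word he hℓ step w hw.1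
    rw [hw.2] at hn'
    rw [hE hn'] at hle
    exact_mod_cast hle

/-! ### Weighted generating series -/

/-- The generating series `∑ v(a) t^ℓ(a)` of a family with weights `v` and degrees `ℓ`. The
coefficients are finite sums, hence meaningful, when the fibres of `ℓ` are finite. -/
noncomputable def weightSeries {A : Type*} (ℓ : A → ℕ) (v : A → ℚ) : ℚ⟦X⟧ :=
  PowerSeries.mk fun k => ∑ᶠ a ∈ {a | ℓ a = k}, v a

/-- Growth series of a group with a geodesic normal form. -/
theorem growthSeries_eq_weightSeries {G N : Type*} [Group G] {S : Set G} {E : N → G} {ℓ : N → ℕ}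
    {e : N} (he : E e = 1) (hℓ : ℓ e = 0) (hE : Function.Injective E)
    (step : ∀ a, (a ∈ S ∨ a⁻¹ ∈ S) → ∀ n, ∃ n', E n' = a * E n ∧ ℓ n' ≤ ℓ n + 1)
    (upper : ∀ n, HasWordOfLength S (E n) (ℓ n)) :
    growthSeries S = weightSeries ℓ 1 := by
  ext k
  rw [growthSeries, weightSeries, PowerSeries.coeff_mk, PowerSeries.coeff_mk]
  have himg : {g : G | wordLength S g = (k : ℕ∞)} = E '' {n | ℓ n = k} := by
    ext g
    constructor
    · intro hg
      -- A finite word length means that some word represents `g`, so `g` has a normal form.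
      have : ∃ w, IsWordFor S w g := by
        by_contra hne
        push Not at hne
        have : wordLength S g = ⊤ := by simp [wordLength, hne]
        rw [Set.mem_ofPred_eq, this] at hg
        exact ENat.top_ne_natCast k hg
      obtain ⟨w, hw⟩ := this
      obtain ⟨n, hn, -⟩ := exists_normalForm_of_word he hℓ step w hw.1
      rw [hw.2] at hn
      refine ⟨n, ?_, hn⟩
      rw [Set.mem_ofPred_eq, ← hn, wordLength_normalForm he hℓ hE step upper] at hg
      exact_mod_cast hg
    · rintro ⟨n, hn, rfl⟩
      rw [Set.mem_ofPred_eq, wordLength_normalForm he hℓ hE step upper, hn]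
  rw [himg, Set.ncard_image_of_injective _ hE]
  by_cases hf : {n | ℓ n = k}.Finite
  · rw [finsum_mem_eq_finite_toFinset_sum _ hf, Set.ncard_eq_toFinset_card _ hf]
    simp
  · -- An infinite sphere would have the junk cardinality `0` and the junk sum `0`.
    rw [Set.Infinite.ncard hf, finsum_mem_eq_zero_of_infinite]
    · simp
    · have : Function.support (1 : N → ℚ) = Set.univ := by ext; simp
      rw [this, Set.inter_univ]
      exact hf

section weightSeries

variable {A B : Type*} {ℓ : A → ℕ}

theorem coeff_weightSeries (hf : ∀ k, {a | ℓ a = k}.Finite) (v : A → ℚ) (k : ℕ) :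
    PowerSeries.coeff k (weightSeries ℓ v) = ∑ a ∈ (hf k).toFinset, v a := by
  rw [weightSeries, PowerSeries.coeff_mk, finsum_mem_eq_finite_toFinset_sum _ (hf k)]

theorem weightSeries_add (hf : ∀ k, {a | ℓ a = k}.Finite) (u v : A → ℚ) :
    weightSeries ℓ (u + v) = weightSeries ℓ u + weightSeries ℓ v := by
  ext k
  simp [coeff_weightSeries hf, Finset.sum_add_distrib]

theorem weightSeries_comp_equiv (e : B ≃ A) (v : A → ℚ) :
    weightSeries (ℓ ∘ e) (v ∘ e) = weightSeries ℓ v := by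
  ext k
  rw [weightSeries, weightSeries, PowerSeries.coeff_mk, PowerSeries.coeff_mk]
  exact finsum_mem_eq_of_bijOn e ⟨fun a ha => ha, e.injective.injOn, fun a ha =>
    ⟨e.symm a, by simpa using ha, by simp⟩⟩ fun a _ => rfl

theorem weightSeries_subtype (P : A → Prop) [DecidablePred P] (v : A → ℚ) :
    weightSeries (fun a : {a // P a} => ℓ a) (fun a => v a) =
      weightSeries ℓ fun a => if P a then v a else 0 := by
  ext k
  rw [weightSeries, weightSeries, PowerSeries.coeff_mk, PowerSeries.coeff_mk,
    ← finsum_mem_inter_support]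
  symm
  rw [← finsum_mem_inter_support]
  symm
  refine finsum_mem_eq_of_bijOn Subtype.val ⟨?_, Subtype.val_injective.injOn, ?_⟩ ?_
  · rintro ⟨a, ha⟩ h
    simpa [ha] using h
  · intro a h
    have ha : P a := by
      by_contra hP
      simp [hP] at h
    exact ⟨⟨a, ha⟩, by simpa [ha] using h, rfl⟩
  · rintro ⟨a, ha⟩ h
    simp [ha]

theorem weightSeries_single [DecidableEq A] (a₀ : A) (r : ℚ) :
    weightSeries ℓ (fun a => if a = a₀ then r else 0) = PowerSeries.monomial (ℓ a₀) r := by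
  ext k
  rw [weightSeries, PowerSeries.coeff_mk, PowerSeries.coeff_monomial]
  rw [finsum_eq_single _ a₀]
  · by_cases h : ℓ a₀ = k
    · simp [h]
    · simp [h, Ne.symm h]
  · intro a ha
    simp [ha]

/-- Generating series of a fibred family: the degree of `(a, b)` is the degree of `a` plus a degree
of `b` that may depend on `a`. -/
theorem coeff_weightSeries_fibred {d : A → B → ℕ} (hf : ∀ k, {a | ℓ a = k}.Finite)
    (hd : ∀ a k, {b | d a b = k}.Finite) (u : A → ℚ) (v : B → ℚ) (k : ℕ) :
    PowerSeries.coeff k (weightSeries (fun x : A × B => ℓ x.1 + d x.1 x.2)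
        fun x => u x.1 * v x.2) =
      ∑ ij ∈ Finset.HasAntidiagonal.antidiagonal k, ∑ a ∈ (hf ij.1).toFinset,
        u a * PowerSeries.coeff ij.2 (weightSeries (d a) v) := by
  -- The fibre over `k`, split according to the degrees of the two components.
  let T : Finset (Σ _ : ℕ × ℕ, Σ _ : A, B) := (Finset.HasAntidiagonal.antidiagonal k).sigma
    fun ij => (hf ij.1).toFinset.sigma fun a => (hd a ij.2).toFinset
  have hT : ∑ᶠ t ∈ (T : Set (Σ _ : ℕ × ℕ, Σ _ : A, B)), u t.2.1 * v t.2.2 =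
      ∑ᶠ x ∈ {x : A × B | ℓ x.1 + d x.1 x.2 = k}, u x.1 * v x.2 := by
    refine finsum_mem_eq_of_bijOn (fun t => (t.2.1, t.2.2)) ⟨?_, ?_, ?_⟩ fun _ _ => rfl
    · rintro ⟨⟨i, j⟩, a, b⟩ h
      simp only [T, Finset.coe_sigma, Set.mem_sigma_iff, Finset.mem_coe,
        Finset.HasAntidiagonal.mem_antidiagonal, Set.Finite.mem_toFinset, Set.mem_ofPred_eq] at h ⊢
      omega
    · rintro ⟨⟨i, j⟩, a, b⟩ h ⟨⟨i', j'⟩, a', b'⟩ h' heq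
      simp only [T, Finset.coe_sigma, Set.mem_sigma_iff, Finset.mem_coe,
        Finset.HasAntidiagonal.mem_antidiagonal, Set.Finite.mem_toFinset, Set.mem_ofPred_eq] at h h'
      simp only [Prod.mk.injEq] at heq
      obtain ⟨rfl, rfl⟩ := heq
      obtain ⟨-, rfl, rfl⟩ := h
      obtain ⟨-, rfl, rfl⟩ := h'
      rfl
    · rintro ⟨a, b⟩ h
      exact ⟨⟨(ℓ a, d a b), a, b⟩, by simpa [T] using h, rfl⟩
  rw [weightSeries, PowerSeries.coeff_mk, ← hT, finsum_mem_coe_finset, Finset.sum_sigma]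
  refine Finset.sum_congr rfl fun ij _ => ?_
  rw [Finset.sum_sigma]
  refine Finset.sum_congr rfl fun a _ => ?_
  rw [coeff_weightSeries (hd a), Finset.mul_sum]

theorem weightSeries_prod {ℓ' : B → ℕ} (hf : ∀ k, {a | ℓ a = k}.Finite)
    (hf' : ∀ k, {b | ℓ' b = k}.Finite) (u : A → ℚ) (v : B → ℚ) :
    weightSeries (fun x : A × B => ℓ x.1 + ℓ' x.2) (fun x => u x.1 * v x.2) =
      weightSeries ℓ u * weightSeries ℓ' v := by
  ext k
  rw [coeff_weightSeries_fibred (d := fun _ => ℓ') hf fun _ => hf', PowerSeries.coeff_mul]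
  refine Finset.sum_congr rfl fun ij _ => ?_
  rw [coeff_weightSeries hf, Finset.sum_mul]

end weightSeries

/-! ### Finite cyclic groups -/

theorem coeff_cyclicPoly {n : ℕ} (hn : 0 < n) (k : ℕ) :
    (cyclicPoly n).coeff k =
      if k = 0 then 1 else if 2 * k < n then 2 else if 2 * k = n then 1 else 0 := by
  have hsum : ∀ N : ℕ, (∑ j ∈ Finset.Icc 1 N, 2 * (Polynomial.X : ℚ[X]) ^ j).coeff k =
      if 1 ≤ k ∧ k ≤ N then 2 else 0 := by
    intro N
    have h2 : ∀ j : ℕ, (2 * (Polynomial.X : ℚ[X]) ^ j).coeff k = if k = j then 2 else 0 := by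
      intro j
      rw [← Polynomial.C_ofNat, Polynomial.coeff_C_mul_X_pow]
    simp only [Polynomial.finsetSum_coeff, h2, Finset.sum_ite_eq, Finset.mem_Icc]
  unfold cyclicPoly
  split_ifs with he <;>
    simp only [Polynomial.coeff_add, hsum, Polynomial.coeff_one, Polynomial.coeff_X_pow]
  all_goals grind

theorem coeff_middlePoly {n : ℕ} (k : ℕ) :
    (middlePoly n).coeff k = if 2 * k = n then 1 else 0 := by
  unfold middlePoly
  split_ifs with he hk hk <;> simp only [Polynomial.coeff_X_pow, Polynomial.coeff_zero]
  all_goals grind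

theorem ncard_natAbs_valMinAbs {n : ℕ} [NeZero n] (k : ℕ) :
    ({a : ZMod n | a.valMinAbs.natAbs = k}.ncard : ℚ) =
      if k = 0 then 1 else if 2 * k < n then 2 else if 2 * k = n then 1 else 0 := by
  have hn : 0 < n := Nat.pos_of_ne_zero (NeZero.ne n)
  by_cases hk : n < 2 * k
  · have : {a : ZMod n | a.valMinAbs.natAbs = k} = ∅ := by
      ext a
      have := ZMod.natAbs_valMinAbs_le a
      simp only [Set.mem_ofPred_eq, Set.mem_empty_iff_false, iff_false]
      omega
    rw [this, Set.ncard_empty, if_neg (by omega), if_neg (by omega), if_neg (by omega)]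
    norm_num
  · have hset : {a : ZMod n | a.valMinAbs.natAbs = k} =
        {((k : ℤ) : ZMod n), ((-k : ℤ) : ZMod n)} := by
      have hk' : ((k : ℤ) : ZMod n).valMinAbs = k := by
        rw [ZMod.valMinAbs_spec]
        exact ⟨rfl, by constructor <;> omega⟩
      ext a
      simp only [Set.mem_ofPred_eq, Set.mem_insert_iff, Set.mem_singleton_iff]
      constructor
      · intro h
        rw [← ZMod.coe_valMinAbs a]
        obtain h' | h' := Int.natAbs_eq a.valMinAbs <;> rw [h', h] <;> simp
      · rintro (rfl | rfl)
        · rw [hk']; simp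
        · rw [Int.cast_neg, ZMod.natAbs_valMinAbs_neg, hk']; simp
    have heq : ((k : ℤ) : ZMod n) = ((-k : ℤ) : ZMod n) ↔ k = 0 ∨ 2 * k = n := by
      rw [ZMod.intCast_eq_intCast_iff_dvd_sub]
      constructor
      · rintro ⟨c, hc⟩
        have h1 : (n : ℤ) * c ≤ 0 := by omega
        have h2 : -(n : ℤ) ≤ n * c := by omega
        have hn' : (0 : ℤ) < n := by exact_mod_cast hn
        have hc0 : c ≤ 0 := by nlinarith
        have hc1 : -1 ≤ c := by nlinarith
        obtain rfl | rfl : c = 0 ∨ c = -1 := by omega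
        · omega
        · omega
      · rintro (rfl | h)
        · simp
        · exact ⟨-1, by rw [← h]; push_cast; ring⟩
    rw [hset]
    by_cases h : ((k : ℤ) : ZMod n) = ((-k : ℤ) : ZMod n)
    · rw [h, Set.pair_eq_singleton, Set.ncard_singleton]
      have := heq.1 h
      split_ifs <;> first | omega | norm_num
    · rw [Set.ncard_pair h]
      rw [heq] at h
      split_ifs <;> first | omega | norm_num

theorem weightSeries_cyclic (n : ℕ) [NeZero n] :
    weightSeries (fun a : ZMod n => a.valMinAbs.natAbs) 1 = cyclicPoly n := by
  ext k
  rw [coeff_weightSeries fun _ => Set.toFinite _, Polynomial.coeff_coe,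
    coeff_cyclicPoly (Nat.pos_of_ne_zero (NeZero.ne n)), ← ncard_natAbs_valMinAbs,
    Set.ncard_eq_toFinset_card _]
  simp

theorem weightSeries_middle (n : ℕ) [NeZero n] :
    weightSeries (fun a : ZMod n => a.valMinAbs.natAbs)
      (fun a => if 2 * a.valMinAbs = n then 1 else 0) = middlePoly n := by
  ext k
  rw [coeff_weightSeries fun _ => Set.toFinite _, Polynomial.coeff_coe, coeff_middlePoly]
  have hn : 0 < n := Nat.pos_of_ne_zero (NeZero.ne n)
  split_ifs with hk
  · have hk' : ((k : ℤ) : ZMod n).valMinAbs = k := by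
      rw [ZMod.valMinAbs_spec]
      exact ⟨rfl, by constructor <;> omega⟩
    rw [Finset.sum_eq_single ((k : ℤ) : ZMod n)]
    · rw [hk', if_pos (by omega)]
    · intro b _ hb
      refine if_neg fun h => hb (ZMod.injective_valMinAbs ?_)
      rw [hk']
      omega
    · intro h
      exact absurd (by rw [Set.Finite.mem_toFinset, Set.mem_ofPred_eq, hk']; simp) h
  · refine Finset.sum_eq_zero fun a ha => if_neg fun h => hk ?_
    simp only [Set.Finite.mem_toFinset, Set.mem_ofPred_eq] at ha
    omega

theorem valMinAbs_add_int {n : ℕ} [NeZero n] (a : ZMod n) (ε : ℤ) :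
    ∃ d : ℤ, a.valMinAbs + ε = (a + ε).valMinAbs + n * d := by
  have : (((a + ε).valMinAbs : ℤ) : ZMod n) = ((a.valMinAbs + ε : ℤ) : ZMod n) := by
    simp
  rw [ZMod.intCast_eq_intCast_iff_dvd_sub] at this
  obtain ⟨c, hc⟩ := this
  exact ⟨c, by linarith⟩

theorem growthSeries_zmod (n : ℕ) [NeZero n] :
    growthSeries {Multiplicative.ofAdd (1 : ZMod n)} = cyclicPoly n := by
  rw [← weightSeries_cyclic]
  refine growthSeries_eq_weightSeries (E := Multiplicative.ofAdd) (e := 0) rfl (by simp)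
    Multiplicative.ofAdd.injective ?_ ?_
  · intro a ha b
    refine ⟨a.toAdd + b, rfl, ?_⟩
    have h1 : a.toAdd.valMinAbs.natAbs ≤ 1 := by
      have h1' : (1 : ZMod n).valMinAbs.natAbs ≤ 1 := by
        rw [ZMod.valMinAbs_natAbs_eq_min, ZMod.val_one_eq_one_mod]
        exact (min_le_left _ _).trans (Nat.mod_le 1 n)
      rcases ha with ha | ha
      · rw [Set.mem_singleton_iff] at ha
        simpa [ha] using h1'
      · rw [Set.mem_singleton_iff] at ha
        rw [inv_eq_iff_eq_inv] at ha
        simpa [ha, ZMod.natAbs_valMinAbs_neg] using h1'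
    have := ZMod.natAbs_valMinAbs_add_le a.toAdd b
    have := Int.natAbs_add_le a.toAdd.valMinAbs b.valMinAbs
    omega
  · intro b
    have := HasWordOfLength.zpow (Set.mem_singleton (Multiplicative.ofAdd (1 : ZMod n))) b.valMinAbs
    rwa [← ofAdd_zsmul, zsmul_one, ZMod.coe_valMinAbs] at this

/-! ### The infinite cyclic group -/

/-- The series `1 + 2t + 2t² + ⋯`. -/
noncomputable def infiniteCyclicSeries : ℚ⟦X⟧ := PowerSeries.mk fun k => if k = 0 then 1 else 2

theorem one_sub_X_mul_infiniteCyclicSeries :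
    (1 - PowerSeries.X) * infiniteCyclicSeries = 1 + PowerSeries.X := by
  ext k
  rw [sub_mul, one_mul, map_sub, map_add, PowerSeries.coeff_one, PowerSeries.coeff_X]
  rcases k with _ | _ | k
  · simp [infiniteCyclicSeries]
  · simp [infiniteCyclicSeries, PowerSeries.coeff_succ_X_mul]; norm_num
  · simp [infiniteCyclicSeries, PowerSeries.coeff_succ_X_mul]

/-- The distance from `0` to the set of integers `c, c + 1, …, c + m`. -/
def distToInterval (m : ℕ) (c : ℤ) : ℕ := (max c (-(c + m))).toNat

theorem setOf_distToInterval_eq (m k : ℕ) : {c : ℤ | distToInterval m c = k} =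
    ↑(if k = 0 then Finset.Icc (-(m : ℤ)) 0 else ({(k : ℤ), -(k + m : ℤ)} : Finset ℤ)) := by
  ext c
  simp only [distToInterval, Set.mem_ofPred_eq, Finset.mem_coe]
  split_ifs with h
  · rw [Finset.mem_Icc]; omega
  · rw [Finset.mem_insert, Finset.mem_singleton]; omega

theorem finite_distToInterval (m k : ℕ) : {c : ℤ | distToInterval m c = k}.Finite := by
  rw [setOf_distToInterval_eq]
  exact Finset.finite_toSet _

theorem coeff_weightSeries_distToInterval (m k : ℕ) :
    PowerSeries.coeff k (weightSeries (distToInterval m) 1) =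
      PowerSeries.coeff k infiniteCyclicSeries + if k = 0 then (m : ℚ) else 0 := by
  rw [weightSeries, infiniteCyclicSeries, PowerSeries.coeff_mk, PowerSeries.coeff_mk,
    setOf_distToInterval_eq, finsum_mem_coe_finset]
  split_ifs with h
  · simp [add_comm]
  · rw [Pi.one_def, Finset.sum_const, Finset.card_pair (by omega)]
    norm_num

theorem growthSeries_int :
    growthSeries {Multiplicative.ofAdd (1 : ℤ)} = infiniteCyclicSeries := by
  have h : weightSeries (distToInterval 0) 1 = infiniteCyclicSeries := by
    ext k
    rw [coeff_weightSeries_distToInterval]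
    simp
  rw [← h]
  refine growthSeries_eq_weightSeries (E := Multiplicative.ofAdd) (e := 0) rfl rfl
    Multiplicative.ofAdd.injective ?_ ?_
  · intro a ha b
    refine ⟨a.toAdd + b, rfl, ?_⟩
    have h1 : a.toAdd = 1 ∨ a.toAdd = -1 := by
      rcases ha with ha | ha <;> rw [Set.mem_singleton_iff] at ha
      · left; simp [ha]
      · right; rw [inv_eq_iff_eq_inv] at ha; simp [ha]
    simp only [distToInterval]
    omega
  · intro b
    have := HasWordOfLength.zpow (Set.mem_singleton (Multiplicative.ofAdd (1 : ℤ))) b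
    rw [← ofAdd_zsmul, zsmul_one, Int.cast_id] at this
    convert this using 1
    simp only [distToInterval]
    omega

/-! ### Normal forms in an amalgam of two infinite cyclic groups -/

open Monoid.CoprodI (Word)

/-- The cyclic factors `ℤ/n₀` and `ℤ/n₁` of the central quotient, written multiplicatively. -/
abbrev CyclicFactor (n : Bool → ℕ) (i : Bool) : Type := Multiplicative (ZMod (n i))

section syllables

variable {n : Bool → ℕ}

/-- The exponent of least absolute value of a syllable (the positive one for a middle syllable). -/
def syllableExp (s : Σ i, CyclicFactor n i) : ℤ := s.2.toAdd.valMinAbs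

/-- `1` for a middle syllable, that is one whose exponent is half the order of its factor, and `0`
for all others. -/
def middleIndicator (s : Σ i, CyclicFactor n i) : ℕ := if 2 * syllableExp s = n s.1 then 1 else 0

/-- Total length of the syllables of a word. -/
def syllableLength (l : List (Σ i, CyclicFactor n i)) : ℕ :=
  (l.map fun s => (syllableExp s).natAbs).sum

/-- Number of middle syllables of a word. -/
def middleCount (l : List (Σ i, CyclicFactor n i)) : ℕ := (l.map middleIndicator).sum

/-- The element spelled by a list of syllables with the exponents `syllableExp`. -/
def liftList {G : Type*} [Group G] (g : Bool → G) (l : List (Σ i, CyclicFactor n i)) : G :=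
  (l.map fun s => g s.1 ^ syllableExp s).prod

/-- The element `z ^ c * w` of the normal form `(c, w)`. -/
def normalForm {G : Type*} [Group G] (g : Bool → G) (z : G) (x : ℤ × Word (CyclicFactor n)) : G :=
  z ^ x.1 * liftList g x.2.toList

/-- The length of the normal form `(c, w)`. The relation `g ^ (n / 2) = z * g ^ (-(n / 2))` permits
to move any number of factors `z` from the middle syllables of `w` to the central part at no cost,
so that the central part may be any of `c, c + 1, …, c + middleCount w`. -/
def normalFormLength (x : ℤ × Word (CyclicFactor n)) : ℕ :=
  syllableLength x.2.toList + distToInterval (middleCount x.2.toList) x.1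

theorem syllableExp_one (i : Bool) : syllableExp (n := n) ⟨i, 1⟩ = 0 := by
  simp [syllableExp]

theorem middleIndicator_one [∀ i, NeZero (n i)] (i : Bool) : middleIndicator (n := n) ⟨i, 1⟩ = 0 := by
  rw [middleIndicator, syllableExp_one, if_neg]
  have := NeZero.ne (n i)
  simpa [eq_comm] using this

theorem syllableLength_rcons {i : Bool} (p : Word.Pair (CyclicFactor n) i) :
    syllableLength (Word.rcons p).toList =
      (syllableExp ⟨i, p.head⟩).natAbs + syllableLength p.tail.toList := by
  rw [Word.rcons]
  split_ifs with h
  · rw [h, syllableExp_one, Int.natAbs_zero, zero_add]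
  · simp [syllableLength, Word.cons]

theorem middleCount_rcons [∀ i, NeZero (n i)] {i : Bool} (p : Word.Pair (CyclicFactor n) i) :
    middleCount (Word.rcons p).toList =
      middleIndicator ⟨i, p.head⟩ + middleCount p.tail.toList := by
  rw [Word.rcons]
  split_ifs with h
  · rw [h, middleIndicator_one, zero_add]
  · simp [middleCount, Word.cons]

theorem liftList_rcons {G : Type*} [Group G] (g : Bool → G) {i : Bool}
    (p : Word.Pair (CyclicFactor n) i) :
    liftList g (Word.rcons p).toList =
      g i ^ syllableExp ⟨i, p.head⟩ * liftList g p.tail.toList := by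
  rw [Word.rcons]
  split_ifs with h
  · rw [h, syllableExp_one, zpow_zero, one_mul]
  · simp [liftList, Word.cons]

/-- Here `v` and `v'` are the representatives of least absolute value of two consecutive residues
modulo `N`. Passing from one to the other changes the absolute value together with the distance of
the central part from `0` by at most one. -/
theorem leastAbs_step {N : ℕ} (hN : 1 < N) {v v' ε d : ℤ} (hε : ε = 1 ∨ ε = -1)
    (hv : -N < v * 2 ∧ v * 2 ≤ N) (hv' : -N < v' * 2 ∧ v' * 2 ≤ N) (hd : v + ε = v' + N * d)
    (m : ℕ) (c : ℤ) :
    v'.natAbs + distToInterval ((if 2 * v' = N then 1 else 0) + m) (c + d) ≤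
      v.natAbs + distToInterval ((if 2 * v = N then 1 else 0) + m) c + 1 := by
  -- Both representatives lie in an interval of length `N`, so at most one multiple of `N` is
  -- carried to the central part.
  have hd1 : d ≤ 1 := by
    by_contra! h
    have : (N : ℤ) * 2 ≤ N * d := by gcongr; exact h
    omega
  have hd2 : -1 ≤ d := by
    by_contra! h
    have : (N : ℤ) * d ≤ N * (-2) := by gcongr; omega
    omega
  simp only [distToInterval]
  obtain rfl | rfl | rfl : d = 0 ∨ d = 1 ∨ d = -1 := by omega
  all_goals
    split_ifs <;> omega

theorem syllable_step [∀ i, NeZero (n i)] {i : Bool} (hn : 1 < n i) (a : CyclicFactor n i)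
    {ε : ℤ} (hε : ε = 1 ∨ ε = -1) (m : ℕ) (c : ℤ) : ∃ d : ℤ, ∃ b : CyclicFactor n i,
      syllableExp ⟨i, a⟩ + ε = syllableExp ⟨i, b⟩ + n i * d ∧
      (syllableExp ⟨i, b⟩).natAbs + distToInterval (middleIndicator ⟨i, b⟩ + m) (c + d) ≤
        (syllableExp ⟨i, a⟩).natAbs + distToInterval (middleIndicator ⟨i, a⟩ + m) c + 1 := by
  obtain ⟨d, hd⟩ := valMinAbs_add_int a.toAdd ε
  exact ⟨d, Multiplicative.ofAdd (a.toAdd + (ε : ZMod (n i))), hd,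
    leastAbs_step hn hε (ZMod.valMinAbs_mem_Ioc a.toAdd)
      (ZMod.valMinAbs_mem_Ioc (a.toAdd + (ε : ZMod (n i)))) hd m c⟩

end syllables

section upperBound

variable {G : Type*} [Group G] {g : Bool → G} {z : G} {n : Bool → ℕ} {S : Set G}

theorem commute_of_pow_eq (h : ∀ i, g i ^ n i = z) (i : Bool) : Commute z (g i) := by
  rw [← h i]
  exact Commute.pow_self _ _

/-- Flipping the signs of some of the middle exponents of a list of syllables leaves its length
unchanged and divides the element spelled by any power of `z` up to the number of middle
syllables. -/
theorem exists_hasWordOfLength_liftList (h : ∀ i, g i ^ n i = z) (hg : ∀ i, g i ∈ S)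
    (l : List (Σ i, CyclicFactor n i)) (j : ℕ) (hj : j ≤ middleCount l) :
    ∃ u, liftList g l = z ^ j * u ∧ HasWordOfLength S u (syllableLength l) := by
  induction l generalizing j with
  | nil =>
    obtain rfl : j = 0 := by simpa [middleCount] using hj
    exact ⟨1, by simp [liftList], HasWordOfLength.one⟩
  | cons s l ih =>
    have hm : middleCount (s :: l) = middleIndicator s + middleCount l := by simp [middleCount]
    have hs : syllableLength (s :: l) = (syllableExp s).natAbs + syllableLength l := by
      simp [syllableLength]
    have hl : liftList g (s :: l) = g s.1 ^ syllableExp s * liftList g l := by simp [liftList]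
    have hc (j : ℕ) (a : ℤ) : Commute (z ^ j) (g s.1 ^ a) :=
      ((commute_of_pow_eq h s.1).pow_left j).zpow_right a
    rw [hm] at hj
    rw [hs, hl]
    by_cases hjl : j ≤ middleCount l
    · obtain ⟨u, hu, hw⟩ := ih j hjl
      exact ⟨g s.1 ^ syllableExp s * u, by rw [hu, ← mul_assoc, ← (hc _ _).eq, mul_assoc],
        (HasWordOfLength.zpow (hg _) _).mul hw⟩
    · -- Here the first syllable is a middle one and has to supply one factor `z`.
      have hmid : 2 * syllableExp s = n s.1 := by
        by_contra hne
        rw [middleIndicator, if_neg hne] at hj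
        omega
      have hj' : j ≤ middleCount l + 1 := by
        rw [middleIndicator, if_pos hmid] at hj
        omega
      obtain ⟨u, hu, hw⟩ := ih (j - 1) (by omega)
      refine ⟨g s.1 ^ (-syllableExp s) * u, ?_, ?_⟩
      · have hz : g s.1 ^ syllableExp s = z * g s.1 ^ (-syllableExp s) := by
          rw [← h s.1, ← zpow_natCast, ← hmid, ← zpow_add]
          congr 1
          ring
        obtain ⟨j, rfl⟩ : ∃ k, j = k + 1 := ⟨j - 1, by omega⟩
        rw [hu, hz, Nat.add_sub_cancel, pow_succ', mul_assoc, mul_assoc, ← mul_assoc (g s.1 ^ _),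
          ← (hc _ _).eq, mul_assoc]
      · have := (HasWordOfLength.zpow (hg s.1) (-syllableExp s)).mul hw
        rwa [Int.natAbs_neg] at this

theorem hasWordOfLength_normalForm (h : ∀ i, g i ^ n i = z) (hg : ∀ i, g i ∈ S) (hz : z ∈ S)
    (x : ℤ × Word (CyclicFactor n)) :
    HasWordOfLength S (normalForm g z x) (normalFormLength x) := by
  -- Move as many factors `z` as are useful to bring the central exponent close to `0`.
  obtain ⟨j, hj, hd⟩ : ∃ j : ℕ, j ≤ middleCount x.2.toList ∧
      distToInterval (middleCount x.2.toList) x.1 = (x.1 + j).natAbs := by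
    refine ⟨min (middleCount x.2.toList) (-x.1).toNat, min_le_left _ _, ?_⟩
    simp only [distToInterval]
    omega
  obtain ⟨u, hu, hw⟩ := exists_hasWordOfLength_liftList h hg x.2.toList j hj
  rw [normalForm, normalFormLength, hu, hd, ← mul_assoc, ← zpow_natCast, ← zpow_add,
    add_comm (syllableLength _)]
  exact (HasWordOfLength.zpow hz _).mul hw

/-- Multiplying a normal form by a generator gives a normal form at most one longer. -/
theorem normalForm_step [∀ i, NeZero (n i)] (hn : ∀ i, 1 < n i) (h : ∀ i, g i ^ n i = z)
    (hS : ∀ a ∈ S, a = z ∨ ∃ i, a = g i) (a : G) (ha : a ∈ S ∨ a⁻¹ ∈ S)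
    (x : ℤ × Word (CyclicFactor n)) :
    ∃ y : ℤ × Word (CyclicFactor n),
      normalForm g z y = a * normalForm g z x ∧ normalFormLength y ≤ normalFormLength x + 1 := by
  obtain ⟨c, w⟩ := x
  obtain ⟨ε, hε, ha'⟩ : ∃ ε : ℤ, (ε = 1 ∨ ε = -1) ∧ (a = z ^ ε ∨ ∃ i, a = g i ^ ε) := by
    rcases ha with ha | ha
    · exact ⟨1, Or.inl rfl, by simpa using hS a ha⟩
    · exact ⟨-1, Or.inr rfl, by simpa [← inv_eq_iff_eq_inv] using hS _ ha⟩
  obtain rfl | ⟨i, rfl⟩ := ha'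
  · refine ⟨(ε + c, w), by simp [normalForm, zpow_add, mul_assoc], ?_⟩
    simp only [normalFormLength, distToInterval]
    omega
  · obtain ⟨p, rfl⟩ : ∃ p, Word.rcons p = w := ⟨Word.equivPair i w, (Word.equivPair i).left_inv w⟩
    obtain ⟨d, b, hd, hle⟩ := syllable_step (hn i) p.head hε (middleCount p.tail.toList) c
    refine ⟨(c + d, Word.rcons { p with head := b }), ?_, ?_⟩
    · have hc : Commute (z ^ c) (g i ^ ε) := ((commute_of_pow_eq h i).zpow_left _).zpow_right _
      have hexp : g i ^ ε * g i ^ syllableExp ⟨i, p.head⟩ = z ^ d * g i ^ syllableExp ⟨i, b⟩ := by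
        rw [← zpow_add, add_comm, hd, add_comm, zpow_add, zpow_mul, zpow_natCast, h]
      simp only [normalForm, liftList_rcons]
      rw [← mul_assoc (g i ^ ε), ← hc.eq, mul_assoc (z ^ c), ← mul_assoc (g i ^ ε), hexp, zpow_add]
      simp only [mul_assoc]
    · simp only [normalFormLength, syllableLength_rcons, middleCount_rcons]
      omega

end upperBound

/-- Normal forms are distinct in every group that maps to the free product of the cyclic factors,
compatibly with the generators and killing `z`, and that has a homomorphism to `ℤ` not killing
`z`. -/
theorem normalForm_injective {G : Type*} [Group G] {g : Bool → G} {z : G} {n : Bool → ℕ}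
    (φ : G →* Monoid.CoprodI (CyclicFactor n))
    (hφ : ∀ i, φ (g i) = Monoid.CoprodI.of (M := CyclicFactor n) (i := i) (.ofAdd 1))
    (hφz : φ z = 1)
    (ψ : G →* Multiplicative ℤ) (hψz : (ψ z).toAdd ≠ 0) :
    Function.Injective (normalForm (n := n) g z) := by
  have key (l : List (Σ i, CyclicFactor n i)) :
      φ (liftList g l) = (l.map fun s => Monoid.CoprodI.of s.2).prod := by
    rw [liftList, map_list_prod, List.map_map]
    congr 1
    refine List.map_congr_left fun s _ => ?_
    rw [Function.comp_apply, map_zpow, hφ, ← map_zpow, ← ofAdd_zsmul, zsmul_one, syllableExp,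
      ZMod.coe_valMinAbs]
    rfl
  rintro ⟨c, w⟩ ⟨c', w'⟩ heq
  have hw : w = w' := by
    have := congrArg φ heq
    simp only [normalForm, map_mul, map_zpow, hφz, one_zpow, one_mul, key] at this
    exact Word.equiv.symm.injective this
  subst hw
  have hc := congrArg (fun t => (ψ t).toAdd) (mul_right_cancel heq)
  simp only [map_zpow, toAdd_zpow, smul_eq_mul] at hc
  rw [mul_right_cancel₀ hψz hc]

/-! ### Counting reduced words -/

section counting

variable {n : Bool → ℕ} [∀ i, NeZero (n i)]

omit [∀ i, NeZero (n i)] in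
theorem one_le_natAbs_syllableExp {s : Σ i, CyclicFactor n i} (hs : s.2 ≠ 1) :
    1 ≤ (syllableExp s).natAbs := by
  rw [Nat.one_le_iff_ne_zero, Int.natAbs_ne_zero, syllableExp, Ne, ZMod.valMinAbs_eq_zero]
  exact hs

theorem finite_syllableLength (k : ℕ) :
    {w : Word (CyclicFactor n) | syllableLength w.toList = k}.Finite := by
  have hfin : {l : List (Σ i, CyclicFactor n i) | l.length ≤ k}.Finite := by
    have : Finite (Σ i, CyclicFactor n i) :=
      inferInstanceAs (Finite (Σ i, ZMod (n i)))
    exact List.finite_length_le _ k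
  refine (hfin.preimage (f := Word.toList) fun v _ w _ h => Word.ext h).subset fun w hw => ?_
  -- Each syllable contributes at least `1` to the syllable length.
  have key : ∀ l : List (Σ i, CyclicFactor n i), (∀ s ∈ l, s.2 ≠ 1) →
      l.length ≤ syllableLength l := by
    intro l hl
    have := List.card_nsmul_le_sum (l.map fun s => (syllableExp s).natAbs) 1 fun a ha => by
      obtain ⟨s, hs, rfl⟩ := List.mem_map.1 ha
      exact one_le_natAbs_syllableExp (hl s hs)
    simpa [syllableLength] using this
  exact (key _ w.ne_one).trans hw.le

/-- The series of all reduced words with weight `v`. -/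
noncomputable def wordSeries (v : Word (CyclicFactor n) → ℚ) : ℚ⟦X⟧ :=
  weightSeries (fun w : Word (CyclicFactor n) => syllableLength w.toList) v

/-- The series with weight `v` of the reduced words whose first syllable is not in factor `i`. -/
noncomputable def tailSeries (i : Bool) (v : Word (CyclicFactor n) → ℚ) : ℚ⟦X⟧ :=
  weightSeries (fun w : {w : Word (CyclicFactor n) // w.fstIdx ≠ some i} =>
    syllableLength w.1.toList) fun w => v w

theorem finite_syllableLength_subtype (P : Word (CyclicFactor n) → Prop) (k : ℕ) :
    {w : {w // P w} | syllableLength w.1.toList = k}.Finite :=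
  (finite_syllableLength k).preimage Subtype.val_injective.injOn

/-- A reduced word is a (possibly trivial) syllable in factor `i` followed by a reduced word that
does not start in factor `i`. -/
def wordEquivProd (i : Bool) :
    (ZMod (n i) × {w : Word (CyclicFactor n) // w.fstIdx ≠ some i}) ≃ Word (CyclicFactor n) where
  toFun x := Word.rcons ⟨.ofAdd x.1, x.2.1, x.2.2⟩
  invFun w := ((Word.equivPair i w).head.toAdd, ⟨_, (Word.equivPair i w).fstIdx_ne⟩)
  left_inv x := by
    have h := (Word.equivPair i).right_inv ⟨.ofAdd x.1, x.2.1, x.2.2⟩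
    change Word.equivPair i (Word.rcons _) = _ at h
    simp only [h, toAdd_ofAdd]
  right_inv w := (Word.equivPair i).left_inv w

theorem wordSeries_eq_mul_tailSeries (i : Bool) {v : Word (CyclicFactor n) → ℚ}
    (u : ZMod (n i) → ℚ) (t : Word (CyclicFactor n) → ℚ)
    (hv : ∀ p : Word.Pair (CyclicFactor n) i, v (Word.rcons p) = u p.head.toAdd * t p.tail) :
    wordSeries v = weightSeries (fun a : ZMod (n i) => a.valMinAbs.natAbs) u * tailSeries i t := by
  rw [tailSeries, ← weightSeries_prod (fun _ => Set.toFinite _) (finite_syllableLength_subtype _),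
    wordSeries, ← weightSeries_comp_equiv (wordEquivProd i)]
  congr 1
  · funext x
    exact syllableLength_rcons _
  · funext x
    exact hv _

theorem wordSeries_add (u v : Word (CyclicFactor n) → ℚ) :
    wordSeries (u + v) = wordSeries u + wordSeries v :=
  weightSeries_add finite_syllableLength u v

/-- The empty word is counted in both tail series, every other word in exactly one of them. -/
theorem tailSeries_add_tailSeries (v : Word (CyclicFactor n) → ℚ) :
    tailSeries false v + tailSeries true v = wordSeries v + PowerSeries.C (v Word.empty) := by
  classical
  have h0 : PowerSeries.C (v Word.empty) =
      wordSeries fun w : Word (CyclicFactor n) => if w = Word.empty then v Word.empty else 0 := by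
    rw [wordSeries, weightSeries_single,
      show syllableLength (Word.empty : Word (CyclicFactor n)).toList = 0 from rfl,
      PowerSeries.monomial_zero_eq_C_apply]
  rw [h0, ← wordSeries_add, tailSeries, tailSeries,
    weightSeries_subtype (ℓ := fun w : Word (CyclicFactor n) => syllableLength w.toList),
    weightSeries_subtype (ℓ := fun w : Word (CyclicFactor n) => syllableLength w.toList),
    ← weightSeries_add finite_syllableLength, wordSeries]
  congr 1
  funext w
  simp only [Pi.add_apply]
  cases w using Word.consRecOn with
  | empty => simp [Word.empty, Word.fstIdx]
  | cons i m w h1 h2 =>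
    have hne : Word.cons m w h1 h2 ≠ Word.empty := fun h => by
      simpa [Word.cons, Word.empty] using congrArg Word.toList h
    cases i <;> simp [hne]

theorem wordSeries_one_eq (i : Bool) :
    wordSeries (n := n) 1 = (cyclicPoly (n i) : ℚ⟦X⟧) * tailSeries (n := n) i 1 := by
  rw [← weightSeries_cyclic]
  exact wordSeries_eq_mul_tailSeries i 1 1 fun p => by simp

/-- The number of middle syllables, as a rational weight. -/
def middleWeight (w : Word (CyclicFactor n)) : ℚ := middleCount w.toList

theorem wordSeries_middleWeight_eq (i : Bool) :
    wordSeries (n := n) middleWeight = (middlePoly (n i) : ℚ⟦X⟧) * tailSeries (n := n) i 1 +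
      (cyclicPoly (n i) : ℚ⟦X⟧) * tailSeries (n := n) i middleWeight := by
  let u (a : ZMod (n i)) : ℚ := middleIndicator (n := n) ⟨i, .ofAdd a⟩
  have hu : u = fun a : ZMod (n i) => if 2 * a.valMinAbs = n i then 1 else 0 := by
    funext a
    by_cases h : 2 * a.valMinAbs = n i
    · have h1 : middleIndicator (n := n) ⟨i, .ofAdd a⟩ = 1 := if_pos h
      simp only [u, h1, if_pos h, Nat.cast_one]
    · have h0 : middleIndicator (n := n) ⟨i, .ofAdd a⟩ = 0 := if_neg h
      simp only [u, h0, if_neg h, Nat.cast_zero]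
  let head (w : Word (CyclicFactor n)) : ℚ := u (Word.equivPair i w).head.toAdd
  let tail (w : Word (CyclicFactor n)) : ℚ := middleWeight (Word.equivPair i w).tail
  have happ (p : Word.Pair (CyclicFactor n) i) : Word.equivPair i (Word.rcons p) = p :=
    (Word.equivPair i).right_inv p
  have hsplit : middleWeight = head + tail := by
    funext w
    obtain ⟨p, rfl⟩ : ∃ p, Word.rcons p = w := ⟨Word.equivPair i w, (Word.equivPair i).left_inv w⟩
    simp only [head, tail, Pi.add_apply, happ, middleWeight, middleCount_rcons, u,
      Nat.cast_add, ofAdd_toAdd]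
  rw [hsplit, wordSeries_add, ← hsplit, ← weightSeries_middle, ← hu, ← weightSeries_cyclic]
  congr 1
  · exact wordSeries_eq_mul_tailSeries i u 1 fun p => by simp [head, happ]
  · exact wordSeries_eq_mul_tailSeries i 1 middleWeight fun p => by simp [tail, happ]

/-- The growth series of the free product of the two cyclic factors. -/
theorem mul_wordSeries_one :
    ((cyclicPoly (n false) : ℚ⟦X⟧) + cyclicPoly (n true) -
      cyclicPoly (n false) * cyclicPoly (n true)) * wordSeries (n := n) 1 =
      cyclicPoly (n false) * cyclicPoly (n true) := by
  have h0 := wordSeries_one_eq (n := n) false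
  have h1 := wordSeries_one_eq (n := n) true
  have h := tailSeries_add_tailSeries (n := n) 1
  rw [Pi.one_apply, map_one] at h
  linear_combination (cyclicPoly (n true) : ℚ⟦X⟧) * h0 + (cyclicPoly (n false) : ℚ⟦X⟧) * h1 +
    (cyclicPoly (n false) : ℚ⟦X⟧) * cyclicPoly (n true) * h

/-- The series counting middle syllables in all reduced words; it is the derivative of the growth
series of the free product when each `C_r` is moved in the direction `m_r`. -/
theorem sq_mul_wordSeries_middleWeight :
    ((cyclicPoly (n false) : ℚ⟦X⟧) + cyclicPoly (n true) -
      cyclicPoly (n false) * cyclicPoly (n true)) ^ 2 * wordSeries (n := n) middleWeight =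
      middlePoly (n true) * (cyclicPoly (n false) : ℚ⟦X⟧) ^ 2 +
        middlePoly (n false) * (cyclicPoly (n true) : ℚ⟦X⟧) ^ 2 := by
  have h0 := wordSeries_one_eq (n := n) false
  have h1 := wordSeries_one_eq (n := n) true
  have h := tailSeries_add_tailSeries (n := n) 1
  have hm0 := wordSeries_middleWeight_eq (n := n) false
  have hm1 := wordSeries_middleWeight_eq (n := n) true
  have hm := tailSeries_add_tailSeries (n := n) middleWeight
  rw [Pi.one_apply, map_one] at h
  have hempty : middleWeight (n := n) Word.empty = 0 := by
    simp [middleWeight, middleCount, Word.empty]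
  rw [hempty, map_zero, add_zero] at hm
  generalize (cyclicPoly (n false) : ℚ⟦X⟧) = P at *
  generalize (cyclicPoly (n true) : ℚ⟦X⟧) = Q at *
  generalize (middlePoly (n false) : ℚ⟦X⟧) = a at *
  generalize (middlePoly (n true) : ℚ⟦X⟧) = b at *
  generalize wordSeries (n := n) 1 = W at *
  generalize wordSeries (n := n) middleWeight = M at *
  generalize tailSeries (n := n) false 1 = U at *
  generalize tailSeries (n := n) true 1 = V at *
  -- The tail series are `V = P / D` and `U = Q / D` for the denominator `D = P + Q - P * Q`.
  have hV : (P + Q - P * Q) * V = P := by linear_combination h0 - h1 + P * h1 + P * h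
  have hU : (P + Q - P * Q) * U = Q := by linear_combination h1 - h0 + Q * h0 + Q * h
  have hM : (P + Q - P * Q) * M = P * b * V + Q * a * U := by
    linear_combination Q * hm0 + P * hm1 + P * Q * hm
  linear_combination (P + Q - P * Q) * hM + P * b * hV + Q * a * hU

/-- Summing over the central exponent: each reduced word contributes `C_∞` plus its number of
middle syllables. -/
theorem weightSeries_normalFormLength :
    weightSeries (normalFormLength (n := n)) 1 =
      infiniteCyclicSeries * wordSeries (n := n) 1 + wordSeries (n := n) middleWeight := by
  rw [← weightSeries_comp_equiv (Equiv.prodComm (Word (CyclicFactor n)) ℤ)]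
  ext k
  have h := coeff_weightSeries_fibred
    (d := fun w : Word (CyclicFactor n) => distToInterval (middleCount w.toList))
    (finite_syllableLength (n := n)) (fun w => finite_distToInterval _) 1 1 k
  simp only [Pi.one_apply, one_mul] at h
  refine Eq.trans ?_ (h.trans ?_)
  · congr 2
  · have h1 : wordSeries (n := n) middleWeight = wordSeries (n := n) middleWeight * 1 := by
      rw [mul_one]
    rw [h1, mul_comm infiniteCyclicSeries, map_add, PowerSeries.coeff_mul, PowerSeries.coeff_mul,
      ← Finset.sum_add_distrib]
    refine Finset.sum_congr rfl fun ij _ => ?_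
    rw [wordSeries, wordSeries, coeff_weightSeries finite_syllableLength,
      coeff_weightSeries finite_syllableLength, Finset.sum_mul, Finset.sum_mul,
      ← Finset.sum_add_distrib]
    refine Finset.sum_congr rfl fun w _ => ?_
    rw [coeff_weightSeries_distToInterval, PowerSeries.coeff_one, middleWeight]
    simp

end counting

/-! ### The torus link groups -/

section torus

variable (p q : ℕ)

/-- The exponents `p` and `q`, indexed by the two factors. -/
def torusExponent : Bool → ℕ := fun i => cond i q p

/-- The generators `x` and `y`, indexed by the two factors. -/
def torusFactorGen : Bool → TorusLinkGroup p q :=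
  fun i => cond i (PresentedGroup.of TorusGen.y) (PresentedGroup.of TorusGen.x)

theorem torusFactorGen_pow (i : Bool) :
    torusFactorGen p q i ^ torusExponent p q i = PresentedGroup.of TorusGen.z := by
  have hy : (PresentedGroup.of TorusGen.y : TorusLinkGroup p q) ^ q =
      PresentedGroup.of TorusGen.z :=
    PresentedGroup.mk_eq_mk_of_mul_inv_mem (x := FreeGroup.of TorusGen.y ^ q)
      (y := FreeGroup.of TorusGen.z) (by simp [torusRelators])
  cases i
  · refine Eq.trans ?_ hy
    exact PresentedGroup.mk_eq_mk_of_mul_inv_mem (x := FreeGroup.of TorusGen.x ^ p)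
      (y := FreeGroup.of TorusGen.y ^ q) (by simp [torusRelators])
  · exact hy

/-- Universal property of the torus link group. -/
theorem exists_torusHom {G : Type*} [Group G] (a b c : G) (hab : a ^ p = b ^ q) (hbc : b ^ q = c) :
    ∃ φ : TorusLinkGroup p q →* G, (∀ i, φ (torusFactorGen p q i) = cond i b a) ∧
      φ (PresentedGroup.of TorusGen.z) = c := by
  let f : TorusGen → G := fun t => match t with
    | .x => a
    | .y => b
    | .z => c
  have hf : ∀ r ∈ torusRelators p q, FreeGroup.lift f r = 1 := by
    rintro r (rfl | rfl)
    · simp [f, hab]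
    · simp [f, hbc]
  refine ⟨PresentedGroup.toGroup hf, fun i => ?_, PresentedGroup.toGroup.of hf⟩
  cases i <;> exact PresentedGroup.toGroup.of hf

theorem growthSeries_torus (hp : 1 < p) (hq : 1 < q) [∀ i, NeZero (torusExponent p q i)] :
    growthSeries (torusGenerators p q) =
      weightSeries (normalFormLength (n := torusExponent p q)) 1 := by
  have hn : ∀ i, 1 < torusExponent p q i := by rintro (_ | _) <;> assumption
  have hpow (i : Bool) : (Monoid.CoprodI.of (M := CyclicFactor (torusExponent p q)) (i := i)
      (Multiplicative.ofAdd 1)) ^ torusExponent p q i = 1 := by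
    rw [← map_pow, ← ofAdd_nsmul, nsmul_one, ZMod.natCast_self, ofAdd_zero, map_one]
  obtain ⟨φ, hφ, hφz⟩ := exists_torusHom p q
    (Monoid.CoprodI.of (M := CyclicFactor (torusExponent p q)) (i := false) (.ofAdd 1))
    (Monoid.CoprodI.of (M := CyclicFactor (torusExponent p q)) (i := true) (.ofAdd 1)) 1
    ((hpow false).trans (hpow true).symm) (hpow true)
  obtain ⟨ψ, -, hψz⟩ := exists_torusHom p q (Multiplicative.ofAdd (q : ℤ))
    (Multiplicative.ofAdd (p : ℤ)) (Multiplicative.ofAdd (p * q : ℤ))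
    (by rw [← ofAdd_nsmul, ← ofAdd_nsmul, nsmul_eq_mul, nsmul_eq_mul, mul_comm])
    (by rw [← ofAdd_nsmul, nsmul_eq_mul, mul_comm])
  have hmem : ∀ i, torusFactorGen p q i ∈ torusGenerators p q := by
    rintro (_ | _) <;> simp [torusFactorGen, torusGenerators]
  refine growthSeries_eq_weightSeries
    (E := normalForm (torusFactorGen p q) (PresentedGroup.of TorusGen.z))
    (e := (0, Word.empty)) rfl rfl
    (normalForm_injective φ ?_ hφz ψ ?_)
    (normalForm_step hn (torusFactorGen_pow p q) ?_)
    (hasWordOfLength_normalForm (torusFactorGen_pow p q) hmem (by simp [torusGenerators]))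
  · intro i
    rw [hφ]
    cases i <;> rfl
  · rw [hψz, toAdd_ofAdd]
    positivity
  · rintro a (rfl | rfl | rfl)
    exacts [Or.inr ⟨false, rfl⟩, Or.inr ⟨true, rfl⟩, Or.inl rfl]

end torus

/-! ### Rational functions -/

-- The algebra structure behind the coercion of rational functions to Laurent series is scoped.
open scoped RatFunc

theorem coe_powerSeries_cyclicPoly (n : ℕ) :
    (((cyclicPoly n : ℚ[X]) : ℚ⟦X⟧) : ℚ⸨X⸩) = ((cyclicRat n : RatFunc ℚ) : ℚ⸨X⸩) :=
  RatFunc.coe_coe _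

theorem coe_powerSeries_middlePoly (n : ℕ) :
    (((middlePoly n : ℚ[X]) : ℚ⟦X⟧) : ℚ⸨X⸩) = ((middleRat n : RatFunc ℚ) : ℚ⸨X⸩) :=
  RatFunc.coe_coe _

theorem coe_infiniteCyclicSeries :
    ((infiniteCyclicSeries : ℚ⟦X⟧) : ℚ⸨X⸩) = ((infiniteCyclicRat : RatFunc ℚ) : ℚ⸨X⸩) := by
  have h := congrArg (HahnSeries.ofPowerSeries ℤ ℚ) one_sub_X_mul_infiniteCyclicSeries
  have hX : HahnSeries.ofPowerSeries ℤ ℚ PowerSeries.X =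
      algebraMap (RatFunc ℚ) ℚ⸨X⸩ RatFunc.X := by
    rw [PowerSeries.coe_X, RatFunc.coe_X]
  have hne : (1 - RatFunc.X : RatFunc ℚ) ≠ 0 := by
    rw [← RatFunc.algebraMap_X, ← map_one (algebraMap ℚ[X] (RatFunc ℚ)), ← map_sub, Ne,
      map_eq_zero_iff _ (RatFunc.algebraMap_injective ℚ)]
    intro h0
    simpa using congrArg (Polynomial.eval 0) h0
  rw [map_mul, map_sub, map_add, map_one, hX] at h
  rw [infiniteCyclicRat, map_div₀, map_add, map_sub, map_one, ← h, mul_div_cancel_left₀]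
  rw [← map_one (algebraMap (RatFunc ℚ) ℚ⸨X⸩), ← map_sub]
  exact (map_ne_zero _).2 hne

/-- The first two conjuncts say that `C_n` and `C_∞` are the growth series of the cyclic groups;
the last one is the formula for the growth series of `⟨x, y, z | x ^ p = y ^ q = z⟩`. -/
theorem mainTheorem1 (p q : ℕ) (hp : 1 < p) (hq : 1 < q) :
    (∀ n : ℕ, 0 < n →
      ((growthSeries {Multiplicative.ofAdd (1 : ZMod n)} : ℚ⟦X⟧) : ℚ⸨X⸩)
        = ((cyclicRat n : RatFunc ℚ) : ℚ⸨X⸩)) ∧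
    ((growthSeries {Multiplicative.ofAdd (1 : ℤ)} : ℚ⟦X⟧) : ℚ⸨X⸩)
      = ((infiniteCyclicRat : RatFunc ℚ) : ℚ⸨X⸩) ∧
    ((growthSeries (torusGenerators p q) : ℚ⟦X⟧) : ℚ⸨X⸩)
      = ((infiniteCyclicRat * cyclicRat p * cyclicRat q
            / (cyclicRat p + cyclicRat q - cyclicRat p * cyclicRat q)
          + (middleRat q * cyclicRat p ^ 2 + middleRat p * cyclicRat q ^ 2)
            / (cyclicRat p + cyclicRat q - cyclicRat p * cyclicRat q) ^ 2 : RatFunc ℚ) :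
          ℚ⸨X⸩) := by
  refine ⟨fun n hn => ?_, ?_, ?_⟩
  · have : NeZero n := ⟨hn.ne'⟩
    rw [growthSeries_zmod, coe_powerSeries_cyclicPoly]
  · rw [growthSeries_int, coe_infiniteCyclicSeries]
  · have : ∀ i, NeZero (torusExponent p q i) := by
      rintro (_ | _)
      exacts [⟨(zero_lt_one.trans hp).ne'⟩, ⟨(zero_lt_one.trans hq).ne'⟩]
    have hgrowth := (growthSeries_torus p q hp hq).trans weightSeries_normalFormLength
    have hW := mul_wordSeries_one (n := torusExponent p q)
    have hM := sq_mul_wordSeries_middleWeight (n := torusExponent p q)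
    have hD := (map_ne_zero (algebraMap (RatFunc ℚ) ℚ⸨X⸩)).2
      (cyclicRat_denominator_ne_zero (zero_lt_one.trans hp) (zero_lt_one.trans hq))
    apply_fun HahnSeries.ofPowerSeries ℤ ℚ at hW hM
    simp only [torusExponent, cond_true, cond_false, map_mul, map_add, map_sub, map_pow,
      coe_powerSeries_cyclicPoly, coe_powerSeries_middlePoly] at hW hM
    rw [hgrowth]
    simp only [map_mul, map_add, map_sub, map_pow, map_div₀, coe_infiniteCyclicSeries] at hD ⊢
    rw [mul_assoc, mul_div_assoc]
    congr 1
    · rw [eq_div_of_mul_eq hD ((mul_comm _ _).trans hW)]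
    · exact eq_div_of_mul_eq (pow_ne_zero 2 hD) ((mul_comm _ _).trans hM)
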